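/- Let $(\Omega,\mathcal F,\mathbb P_0)$ be a probability space, $X:\Omega\to\mathbb R$ a random variable with $X\in L^1(\mathbb P_0)$ whose distribution under $\mathbb P_0$ has a real-valued density $f_0\ge 0$ with respect to a $\sigma$-finite measure $\mathrm dx$ on $\mathbb R$ (e.g. Lebesgue measure), and let $r>0$. Let $\Phi_0$ be the set of convex functions $\phi:\mathbb R\to[0,\infty]$ with $\phi(1)=0$ whose effective domain $\{t:\phi(t)<\infty\}$ is contained in $[0,\infty)$ and contains a neighborhood of $1$. For probability measures $\mathbb Q,\mathbb P$ put $I_\phi(\mathbb Q,\mathbb P)=\int\phi\left(\frac{\mathrm d\mathbb Q}{\mathrm d\mathbb P}\right)\mathrm d\mathbb P$ if $\mathbb Q\ll\mathbb P$ and $I_\phi(\mathbb Q,\mathbb P)=+\infty$ otherwise. Let $\phi^*(y)=\sup_{t\in\mathbb R}\{yt-\phi(t)\}$ be the convex conjugate, with $\phi^*(+\infty)=+\infty$ and the convention that $0\,\phi^*(s/0)$ is $0$ if $s\le 0$ and $+\infty$ if $s>0$. For lower-semicontinuous $\phi_1,\phi_2\in\Phi_0$ define $$\rho^s(X)=\sup_{\mathbb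 Q:\,I_{\phi_2}(\mathbb Q,\mathbb P_0)\le r}\ \sup_{\bar{\mathbb Q}\ll\mathbb Q}\ \mathbb E_{\bar{\mathbb Q}}[-X]-I_{\phi_1}(\bar{\mathbb Q},\mathbb Q),$$ $$\rho^l(X)=\sup_{\mathbb Q\ll\mathbb P_0}\ \sup_{\bar{\mathbb Q}\ll\mathbb Q}\ \mathbb E_{\bar{\mathbb Q}}[-X]-I_{\phi_1}(\bar{\mathbb Q},\mathbb Q)-I_{\phi_2}(\mathbb Q,\mathbb P_0),$$ where $\mathbb Q,\bar{\mathbb Q}$ range over probability measures on $(\Omega,\mathcal F)$ and an undefined value $\infty-\infty$ of an objective is read as $-\infty$. Then $\rho^s(X)<\infty$ if and only if there exist $\theta_1,\theta_2\in\mathbb R$ and $\lambda\ge 0$ such that $$\int_{\mathbb R}\lambda\,\phi_2^*\left(\frac{\phi_1^*(\theta_2-x)+\theta_1}{\lambda}\right)f_0(x)\,\mathrm dx<\infty.$$ Similarly, $\rho^l(X)<\infty$ if and only if there exist $\theta_1,\theta_2\in\mathbb R$ such that $$\int_{\mathbb R}\phi_2^*\left(\phi_1^*(\theta_2-x)+\theta_1\right)f_0(x)\,\mathrm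 dx<\infty.$$ -/

import Mathlib

open MeasureTheory
open scoped ENNReal NNReal Topology

noncomputable section

namespace RobustOCE

/-- The effective domain of an extended-valued function. -/
def effDom (φ : ℝ → ℝ≥0∞) : Set ℝ := {t | φ t < ⊤}

/-- The class of divergence functions: `[0, ∞]`-valued convex functions on the real line with
`φ 1 = 0`, whose effective domain lies in `[0, ∞)` and contains a neighborhood of `1`. -/
def Phi0 : Set (ℝ → ℝ≥0∞) :=
  {φ | ConvexOn ℝ≥0 Set.univ φ ∧ φ 1 = 0 ∧ effDom φ ⊆ Set.Ici 0 ∧ effDom φ ∈ 𝓝 (1 : ℝ)}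

/-- The divergence `I_φ(Q, P)`: the integral of `φ (dQ/dP)` against `P` if `Q ≪ P`, and `+∞`
otherwise. -/
def divergence {Ω : Type*} [MeasurableSpace Ω] (φ : ℝ → ℝ≥0∞) (Q P : Measure Ω) : ℝ≥0∞ :=
  open Classical in
  if Q ≪ P then ∫⁻ ω, φ ((Q.rnDeriv P ω).toReal) ∂P else ⊤

/-- The integral, in `[-∞, ∞]`, of an extended-real function: the integral of the positive part
minus the integral of the negative part, read as `+∞` as soon as the positive part has infinite
integral. -/
def extIntegral {α : Type*} [MeasurableSpace α] (μ : Measure α) (h : α → EReal) : EReal :=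
  open Classical in
  if ∫⁻ x, (h x).toENNReal ∂μ = ⊤ then ⊤
  else ((∫⁻ x, (h x).toENNReal ∂μ : ℝ≥0∞) : EReal) - ((∫⁻ x, (-h x).toENNReal ∂μ : ℝ≥0∞) : EReal)

/-- The convex conjugate `φ* y = sup_x (y x - φ x)`. The argument is extended-real so that
conjugates can be composed; for `φ ∈ Phi0` the formula gives `φ* (+∞) = +∞`, since `φ 1 = 0`. -/
def conj (φ : ℝ → ℝ≥0∞) (y : EReal) : EReal :=
  ⨆ x : ℝ, y * (x : EReal) - ((φ x : ℝ≥0∞) : EReal)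

/-- `lam φ* (s / lam)` for `lam > 0`, with the convention that for `lam = 0` it is `0` if `s ≤ 0`
and `+∞` if `s > 0`. -/
def scaledConj (φ : ℝ → ℝ≥0∞) (lam : ℝ) (s : EReal) : EReal :=
  open Classical in
  if lam = 0 then (if s ≤ 0 then 0 else ⊤) else (lam : EReal) * conj φ (s / (lam : EReal))

/-- The objective `E_R[-X] - I_φ(R, Q)` of the optimized certainty equivalent at the probability
measure `R` with respect to `Q`. It is `-∞` if `I_φ(R, Q) = ∞` (because `a - ⊤ = ⊥` for all `a` in
`EReal`), or if `X` has a positive part with infinite `R`-expectation. -/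
def oceObjective {Ω : Type*} [MeasurableSpace Ω] (φ : ℝ → ℝ≥0∞) (X : Ω → ℝ) (R Q : Measure Ω) :
    EReal :=
  -extIntegral R (fun ω => (X ω : EReal)) - ((divergence φ R Q : ℝ≥0∞) : EReal)

/-- The robust optimized certainty equivalent over the divergence ball of radius `r`:
`sup {E_R[-X] - I_φ₁(R, Q) | I_φ₂(Q, P₀) ≤ r, R ≪ Q}`, over probability measures `Q`, `R`. -/
def rhoS {Ω : Type*} [MeasurableSpace Ω] (φ₁ φ₂ : ℝ → ℝ≥0∞) (r : ℝ) (P₀ : Measure Ω)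
    (X : Ω → ℝ) : EReal :=
  ⨆ (Q : ProbabilityMeasure Ω) (_ : divergence φ₂ (Q : Measure Ω) P₀ ≤ ENNReal.ofReal r)
    (R : ProbabilityMeasure Ω) (_ : (R : Measure Ω) ≪ (Q : Measure Ω)),
    oceObjective φ₁ X (R : Measure Ω) (Q : Measure Ω)

/-- The penalized robust optimized certainty equivalent:
`sup {E_R[-X] - I_φ₁(R, Q) - I_φ₂(Q, P₀) | Q ≪ P₀, R ≪ Q}`, over probability measures `Q`, `R`. -/
def rhoL {Ω : Type*} [MeasurableSpace Ω] (φ₁ φ₂ : ℝ → ℝ≥0∞) (P₀ : Measure Ω)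
    (X : Ω → ℝ) : EReal :=
  ⨆ (Q : ProbabilityMeasure Ω) (_ : (Q : Measure Ω) ≪ P₀)
    (R : ProbabilityMeasure Ω) (_ : (R : Measure Ω) ≪ (Q : Measure Ω)),
    oceObjective φ₁ X (R : Measure Ω) (Q : Measure Ω)
      - ((divergence φ₂ (Q : Measure Ω) P₀ : ℝ≥0∞) : EReal)

end RobustOCE

end

namespace RobustOCE

/-! Both equivalences are Lagrangian duality for a concave problem under moment constraints. Write
`Z = dQ/dP₀`, `W = dR/dQ` and `V = ZW`.

Sufficiency is weak duality. Applying Fenchel-Young to `φ₁` and then to `φ₂` gives `z(wy + θ₁) ≤ z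
φ₁(w) + λ φ₂(z) + λ φ₂*((φ₁*(y) + θ₁)/λ)`. At `y = θ₂ - X`, integration against `P₀` bounds
`E_R[-X]` by the two penalties plus a constant (`lintegral_neg_le`).

Necessity is strong duality. In the variables `(V, Z)` the first penalty is the perspective `z
φ₁(v/z)`, which is jointly convex, so the moments of simple functions with values in
`penaltyEpigraph` form a convex set in finite dimensions. Finiteness of the risk measure bounds its
fibre over unit masses (and over radius `r` for `rhoS`), constant functions give Slater's condition,
and Hahn-Banach supplies multipliers (`exists_affine_bound`). The Lagrangian is then bounded over
all admissible simple functions. Exchanging supremum and integral turns this into integrability of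
its pointwise supremum, whose positive part is that of the composed conjugate
(`lintegral_scaledConj_lt_top`). -/

/-! ### Conjugates and the pointwise Fenchel-Young inequality. -/

theorem eq_top_of_neg {φ : ℝ → ℝ≥0∞} (h : effDom φ ⊆ Set.Ici 0) {t : ℝ} (ht : t < 0) :
    φ t = ⊤ := by
  by_contra hne
  exact absurd (h (show φ t < ⊤ from Ne.lt_top hne)) (by simpa using ht)

theorem nonneg_of_ne_top {φ : ℝ → ℝ≥0∞} (h : effDom φ ⊆ Set.Ici 0) {t : ℝ} (ht : φ t ≠ ⊤) :
    0 ≤ t := by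
  by_contra hneg
  exact ht (eq_top_of_neg h (not_le.1 hneg))

/-- Only slopes `x ≥ 0` contribute to the supremum, since `φ` is infinite on the negative axis. -/
theorem conj_mono {φ : ℝ → ℝ≥0∞} (h : effDom φ ⊆ Set.Ici 0) : Monotone (conj φ) := by
  intro y y' hyy
  refine iSup_mono fun x => ?_
  rcases lt_or_ge x 0 with hx | hx
  · simp [eq_top_of_neg h hx]
  · exact EReal.sub_le_sub (mul_le_mul_of_nonneg_right hyy (EReal.coe_nonneg.2 hx)) le_rfl

theorem coe_toReal_ennreal {a : ℝ≥0∞} (h : a ≠ ⊤) : (a : EReal) = ((a.toReal : ℝ) : EReal) := by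
  lift a to ℝ≥0 using h
  rfl

theorem le_conj (φ : ℝ → ℝ≥0∞) (y : ℝ) {x : ℝ} (hx : φ x ≠ ⊤) :
    ((y * x - (φ x).toReal : ℝ) : EReal) ≤ conj φ y := by
  refine le_trans (le_of_eq ?_) (le_iSup _ x)
  rw [coe_toReal_ennreal hx]
  push_cast
  rfl

theorem exists_of_lt_conj {φ : ℝ → ℝ≥0∞} {q : ℝ} {y : EReal} (h : (q : EReal) < conj φ y) :
    ∃ x, φ x ≠ ⊤ ∧ (q : EReal) < y * (x : EReal) - ((φ x).toReal : ℝ) := by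
  obtain ⟨x, hx⟩ := lt_iSup_iff.1 h
  have hne : φ x ≠ ⊤ := by
    intro ht
    simp [ht] at hx
  exact ⟨x, hne, by rwa [coe_toReal_ennreal hne] at hx⟩

theorem scaledConj_one (φ : ℝ → ℝ≥0∞) (s : EReal) : scaledConj φ 1 s = conj φ s := by
  simp [scaledConj]

theorem scaledConj_mono {φ : ℝ → ℝ≥0∞} (h : effDom φ ⊆ Set.Ici 0) {lam : ℝ} (hlam : 0 ≤ lam) :
    Monotone (scaledConj φ lam) := by
  intro s s' hs
  unfold scaledConj
  by_cases h0 : lam = 0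
  · simp only [h0, if_true]
    by_cases h1 : s' ≤ 0
    · simp [h1, hs.trans h1]
    · simp [h1]
  · simp only [h0, if_false]
    exact mul_le_mul_of_nonneg_left (conj_mono h
      (EReal.div_le_div_right_of_nonneg (EReal.coe_nonneg.2 hlam) hs)) (EReal.coe_nonneg.2 hlam)

/-- The Fenchel-Young inequality for the composed conjugate. -/
theorem ofReal_le_scaledConj {φ₁ φ₂ : ℝ → ℝ≥0∞} (h : effDom φ₂ ⊆ Set.Ici 0) {lam : ℝ}
    (hlam : 0 ≤ lam) (θ y w : ℝ) {z : ℝ} (hz : 0 ≤ z) :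
    ENNReal.ofReal (z * (w * y + θ)) ≤ ENNReal.ofReal z * φ₁ w + ENNReal.ofReal lam * φ₂ z
      + (scaledConj φ₂ lam (conj φ₁ (y : EReal) + (θ : EReal))).toENNReal := by
  rcases hz.eq_or_lt with rfl | hz
  · simp
  by_cases hw : φ₁ w = ⊤
  · simp [hw, hz]
  set p := (φ₁ w).toReal with hp
  set t : ℝ := y * w - p + θ with ht
  have hs : (t : EReal) ≤ conj φ₁ (y : EReal) + (θ : EReal) := by
    rw [ht, EReal.coe_add]
    exact add_le_add_left (le_conj φ₁ y hw) _
  refine le_trans ?_ (add_le_add_right (EReal.toENNReal_le_toENNReal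
    (scaledConj_mono h hlam hs)) _)
  have hφ₁ : φ₁ w = ENNReal.ofReal p := (ENNReal.ofReal_toReal hw).symm
  have hp0 : 0 ≤ p := ENNReal.toReal_nonneg
  -- For `lam = 0` the convention is the supremum of `z * s` over `z ≥ 0`: either `t ≤ 0` and the
  -- penalty `z * p` suffices, or the right-hand side is infinite.
  rcases hlam.eq_or_lt with rfl | hlam
  · by_cases ht0 : t ≤ 0
    · rw [hφ₁, ← ENNReal.ofReal_mul hz.le]
      refine le_trans (ENNReal.ofReal_le_ofReal ?_) (le_trans le_self_add le_self_add)
      nlinarith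
    · have : ¬ (t : EReal) ≤ 0 := by exact_mod_cast ht0
      simp [scaledConj, this]
  · by_cases hq : φ₂ z = ⊤
    · simp [hq, hlam]
    set q := (φ₂ z).toReal with hq'
    have hφ₂ : φ₂ z = ENNReal.ofReal q := (ENNReal.ofReal_toReal hq).symm
    have hq0 : 0 ≤ q := ENNReal.toReal_nonneg
    have h3 : ((lam * (t / lam * z - q) : ℝ) : EReal) ≤ scaledConj φ₂ lam (t : EReal) := by
      rw [scaledConj, if_neg hlam.ne', EReal.coe_mul]
      refine mul_le_mul_of_nonneg_left ?_ (EReal.coe_nonneg.2 hlam.le)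
      rw [← EReal.coe_div]
      exact le_conj φ₂ _ hq
    have h4 := EReal.toENNReal_le_toENNReal h3
    rw [EReal.toENNReal_of_ne_top (EReal.coe_ne_top _), EReal.toReal_coe] at h4
    refine le_trans ?_ (add_le_add_right h4 _)
    rw [hφ₁, hφ₂, ← ENNReal.ofReal_mul hz.le, ← ENNReal.ofReal_mul hlam.le,
      ← ENNReal.ofReal_add (by positivity) (by positivity)]
    refine le_trans (ENNReal.ofReal_le_ofReal (le_of_eq ?_)) ENNReal.ofReal_add_le
    field_simp
    rw [ht]
    ring

/-- A nonnegative number below the composed conjugate is exceeded at some pair with finite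
penalties and a positive second component. -/
theorem exists_of_lt_scaledConj {φ₁ φ₂ : ℝ → ℝ≥0∞} (h₂ : effDom φ₂ ⊆ Set.Ici 0) {lam : ℝ}
    (hlam : 0 < lam) {θ y q : ℝ} (hq : 0 ≤ q)
    (h : (q : EReal) < scaledConj φ₂ lam (conj φ₁ (y : EReal) + (θ : EReal))) :
    ∃ w z : ℝ, 0 < z ∧ φ₁ w ≠ ⊤ ∧ φ₂ z ≠ ⊤ ∧
      q < z * (w * y + θ) - z * (φ₁ w).toReal - lam * (φ₂ z).toReal := by
  set s := conj φ₁ (y : EReal) + (θ : EReal) with hs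
  rw [scaledConj, if_neg hlam.ne'] at h
  have h1 : ((q / lam : ℝ) : EReal) < conj φ₂ (s / (lam : EReal)) := by
    rw [EReal.coe_div]
    exact (EReal.div_lt_iff (by exact_mod_cast hlam) (EReal.coe_ne_top _)).2
      (by rwa [mul_comm])
  obtain ⟨z, hz, h2⟩ := exists_of_lt_conj h1
  set b := (φ₂ z).toReal with hb
  have hb0 : 0 ≤ b := ENNReal.toReal_nonneg
  -- At `z = 0` the value is `-φ₂ 0 ≤ 0`, which cannot exceed `q / lam ≥ 0`.
  have hz0 : 0 < z := by
    rcases (nonneg_of_ne_top h₂ hz).eq_or_lt with h0 | h0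
    · rw [← h0, EReal.coe_zero, mul_zero, zero_sub] at h2
      have : q / lam < -b := by exact_mod_cast h2
      have := div_nonneg hq hlam.le
      linarith
    · exact h0
  -- The threshold solves `(s / lam) * z - b = q / lam` for `s`, less `θ`. Arguing by contradiction
  -- also covers an infinite `conj φ₁ y`.
  have h3 : (((q / lam + b) * lam / z - θ : ℝ) : EReal) < conj φ₁ (y : EReal) := by
    by_contra hcon
    have hs' : s ≤ (((q / lam + b) * lam / z : ℝ) : EReal) := by
      refine (add_le_add_left (not_lt.1 hcon) _).trans (le_of_eq ?_)
      rw [← EReal.coe_add]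
      congr 1
      ring
    have h4 : s / (lam : EReal) * (z : EReal) - (b : EReal)
        ≤ (((q / lam + b) * lam / z / lam * z - b : ℝ) : EReal) := by
      rw [EReal.coe_sub, EReal.coe_mul, EReal.coe_div _ lam]
      exact EReal.sub_le_sub (mul_le_mul_of_nonneg_right
        (EReal.div_le_div_right_of_nonneg (EReal.coe_nonneg.2 hlam.le) hs')
        (EReal.coe_nonneg.2 hz0.le)) le_rfl
    have h5 := EReal.coe_lt_coe_iff.1 (h2.trans_le h4)
    rw [show (q / lam + b) * lam / z / lam * z - b = q / lam by field_simp; ring] at h5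
    exact lt_irrefl _ h5
  obtain ⟨w, hw, h6⟩ := exists_of_lt_conj h3
  refine ⟨w, z, hz0, hw, hz, ?_⟩
  have h7 : (q / lam + b) * lam / z - θ < y * w - (φ₁ w).toReal := by exact_mod_cast h6
  have h8 : (q / lam + b) * lam / z < y * w - (φ₁ w).toReal + θ := by linarith
  rw [div_lt_iff₀ hz0] at h8
  have h9 : (q / lam + b) * lam = q + lam * b := by field_simp
  nlinarith

/-- Both conjugates are monotone, so the composition is antitone in `x`. -/
theorem measurable_scaledConj_comp {φ₁ φ₂ : ℝ → ℝ≥0∞} (h₁ : effDom φ₁ ⊆ Set.Ici 0)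
    (h₂ : effDom φ₂ ⊆ Set.Ici 0) {lam : ℝ} (hlam : 0 ≤ lam) (θ₁ θ₂ : ℝ) :
    Measurable fun x : ℝ =>
      scaledConj φ₂ lam (conj φ₁ ((θ₂ - x : ℝ) : EReal) + (θ₁ : EReal)) := by
  refine Antitone.measurable fun x x' hx => scaledConj_mono h₂ hlam (add_le_add_left
    (conj_mono h₁ ?_) _)
  exact EReal.coe_le_coe_iff.2 (by linarith)

/-! ### Integrals against the density as expectations. -/

/-- Subtracting the negative part can only lower a finite value, so the positive part alone decides.
-/
theorem extIntegral_lt_top_iff {α : Type*} [MeasurableSpace α] (μ : Measure α) (h : α → EReal) :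
    extIntegral μ h < ⊤ ↔ ∫⁻ x, (h x).toENNReal ∂μ < ⊤ := by
  unfold extIntegral
  split_ifs with h0
  · simp [h0]
  · refine ⟨fun _ => Ne.lt_top h0, fun hlt => ?_⟩
    rw [coe_toReal_ennreal hlt.ne]
    refine lt_of_le_of_lt (EReal.sub_le_sub le_rfl (EReal.coe_ennreal_nonneg _)) ?_
    rw [sub_zero]
    exact EReal.coe_lt_top _

/-- Finiteness of an integral against a density, as an expectation. -/
theorem extIntegral_density_lt_top_iff {Ω : Type*} [MeasurableSpace Ω] {P₀ : Measure Ω}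
    {X : Ω → ℝ} (hXm : Measurable X) {μ : Measure ℝ} {f₀ : ℝ → ℝ} (hf₀m : Measurable f₀)
    (hf₀ : ∀ x, 0 ≤ f₀ x)
    (hdens : Measure.map X P₀ = μ.withDensity (fun x => ENNReal.ofReal (f₀ x)))
    {g : ℝ → EReal} (hg : Measurable g) :
    extIntegral μ (fun x => g x * (f₀ x : EReal)) < ⊤ ↔
      ∫⁻ ω, (g (X ω)).toENNReal ∂P₀ < ⊤ := by
  rw [extIntegral_lt_top_iff, ← lintegral_map (f := fun x => (g x).toENNReal)
    hg.ereal_toENNReal hXm, hdens, lintegral_withDensity_eq_lintegral_mul _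
    hf₀m.ennreal_ofReal hg.ereal_toENNReal]
  have : ∀ x, (g x * (f₀ x : EReal)).toENNReal = ENNReal.ofReal (f₀ x) * (g x).toENNReal := by
    intro x
    rw [mul_comm, EReal.toENNReal_mul (EReal.coe_nonneg.2 (hf₀ x))]
    simp
  simp only [this, Pi.mul_apply]

/-! ### Sufficiency: weak duality. -/

/-- The integrated Fenchel-Young inequality. -/
theorem lintegral_neg_le {Ω : Type*} [MeasurableSpace Ω] {P₀ Q R : Measure Ω}
    [IsProbabilityMeasure P₀] [IsProbabilityMeasure Q] [IsProbabilityMeasure R]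
    (hQ : Q ≪ P₀) (hR : R ≪ Q) {X : Ω → ℝ} (hXm : Measurable X)
    {φ₁ φ₂ : ℝ → ℝ≥0∞} (hm₁ : Measurable φ₁) (hm₂ : Measurable φ₂)
    (h₁ : effDom φ₁ ⊆ Set.Ici 0) (h₂ : effDom φ₂ ⊆ Set.Ici 0)
    {lam : ℝ} (hlam : 0 ≤ lam) (θ₁ θ₂ : ℝ) :
    ∫⁻ ω, ENNReal.ofReal (-X ω) ∂ R ≤ ∫⁻ ω, ENNReal.ofReal (X ω) ∂ R + divergence φ₁ R Q
      + ENNReal.ofReal lam * divergence φ₂ Q P₀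
      + (∫⁻ ω, (scaledConj φ₂ lam (conj φ₁ ((θ₂ - X ω : ℝ) : EReal) + (θ₁ : EReal))).toENNReal ∂P₀
        + ENNReal.ofReal |θ₁| + ENNReal.ofReal |θ₂|) := by
  set G : Ω → ℝ≥0∞ := fun ω =>
    (scaledConj φ₂ lam (conj φ₁ ((θ₂ - X ω : ℝ) : EReal) + (θ₁ : EReal))).toENNReal with hG
  have hGm : Measurable G :=
    ((measurable_scaledConj_comp h₁ h₂ hlam θ₁ θ₂).comp hXm).ereal_toENNReal
  set Z : Ω → ℝ≥0∞ := Q.rnDeriv P₀ with hZ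
  set W : Ω → ℝ≥0∞ := R.rnDeriv Q with hW
  have hZm : Measurable Z := Measure.measurable_rnDeriv _ _
  have hWm : Measurable W := Measure.measurable_rnDeriv _ _
  have hmW : Measurable fun ω => φ₁ (W ω).toReal := hm₁.comp hWm.ennreal_toReal
  have hmZ : Measurable fun ω => φ₂ (Z ω).toReal := hm₂.comp hZm.ennreal_toReal
  have hWQ : ∀ F : Ω → ℝ≥0∞, Measurable F → ∫⁻ ω, Z ω * (W ω * F ω) ∂P₀ = ∫⁻ ω, F ω ∂ R := by
    intro F hF
    exact (lintegral_rnDeriv_mul hQ (hWm.mul hF).aemeasurable).trans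
      (lintegral_rnDeriv_mul hR hF.aemeasurable)
  have hI₁ : divergence φ₁ R Q = ∫⁻ ω, Z ω * φ₁ (W ω).toReal ∂P₀ := by
    rw [divergence, if_pos hR, lintegral_rnDeriv_mul hQ hmW.aemeasurable]
  have hI₂ : divergence φ₂ Q P₀ = ∫⁻ ω, φ₂ (Z ω).toReal ∂P₀ := by
    rw [divergence, if_pos hQ]
  have hZtop : ∀ᵐ ω ∂P₀, Z ω ≠ ⊤ := Measure.rnDeriv_ne_top Q P₀
  -- `Z * W` has integral one under `P₀`. This makes `W` finite wherever `Z ≠ 0`; its `Q`-a.e.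
  -- finiteness is not directly a `P₀`-a.e. statement.
  have hZW : ∀ᵐ ω ∂P₀, Z ω * W ω ≠ ⊤ := by
    have hfin : ∫⁻ ω, Z ω * (W ω * 1) ∂P₀ ≠ ⊤ := by
      rw [hWQ (fun _ => 1) measurable_const]
      simp
    filter_upwards [ae_lt_top (hZm.mul (hWm.mul measurable_const)) hfin] with ω hω
    simpa using hω.ne
  have hpt : ∀ᵐ ω ∂P₀, Z ω * (W ω * ENNReal.ofReal (-X ω)) ≤
      Z ω * (W ω * ENNReal.ofReal (X ω)) + Z ω * φ₁ (W ω).toReal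
        + ENNReal.ofReal lam * φ₂ (Z ω).toReal
        + (G ω + Z ω * ENNReal.ofReal |θ₁| + Z ω * (W ω * ENNReal.ofReal |θ₂|)) := by
    filter_upwards [hZtop, hZW] with ω hz hzw
    by_cases h0 : Z ω = 0
    · simp [h0]
    have hw : W ω ≠ ⊤ := by
      intro hw
      simp [hw, h0] at hzw
    have hF := ofReal_le_scaledConj (φ₁ := φ₁) h₂ hlam θ₁ (θ₂ - X ω) (W ω).toReal
      (z := (Z ω).toReal) ENNReal.toReal_nonneg
    rw [ENNReal.ofReal_toReal hz] at hF
    set z := (Z ω).toReal with hzdef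
    set w := (W ω).toReal with hwdef
    have hz0 : 0 ≤ z := ENNReal.toReal_nonneg
    have hw0 : 0 ≤ w := ENNReal.toReal_nonneg
    have hZr : Z ω = ENNReal.ofReal z := (ENNReal.ofReal_toReal hz).symm
    have hWr : W ω = ENNReal.ofReal w := (ENNReal.ofReal_toReal hw).symm
    -- Adding `|θ₁|`, `|θ₂|` and the positive part of `X` on the right avoids any subtraction in
    -- `ℝ≥0∞`.
    have key : Z ω * (W ω * ENNReal.ofReal (-X ω)) ≤
        ENNReal.ofReal (z * (w * (θ₂ - X ω) + θ₁)) + Z ω * (W ω * ENNReal.ofReal (X ω))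
        + Z ω * ENNReal.ofReal |θ₁| + Z ω * (W ω * ENNReal.ofReal |θ₂|) := by
      rw [hZr, hWr]
      simp only [← ENNReal.ofReal_mul hw0, ← ENNReal.ofReal_mul hz0]
      refine le_trans (ENNReal.ofReal_le_ofReal (q := z * (w * (θ₂ - X ω) + θ₁) + z * (w * X ω)
        + z * |θ₁| + z * (w * |θ₂|) - z * (w * X ω)) ?_) ?_
      · have h1 : 0 ≤ z * (θ₁ + |θ₁|) := mul_nonneg hz0 (by linarith [neg_abs_le θ₁])
        have h2 : 0 ≤ z * (w * (θ₂ + |θ₂|)) :=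
          mul_nonneg hz0 (mul_nonneg hw0 (by linarith [neg_abs_le θ₂]))
        nlinarith
      · rw [show z * (w * (θ₂ - X ω) + θ₁) + z * (w * X ω) + z * |θ₁| + z * (w * |θ₂|)
          - z * (w * X ω) = z * (w * (θ₂ - X ω) + θ₁) + z * |θ₁| + z * (w * |θ₂|) by ring]
        refine ENNReal.ofReal_add_le.trans (add_le_add_left ?_ _)
        refine ENNReal.ofReal_add_le.trans (add_le_add_left ?_ _)
        exact le_self_add
    refine key.trans ((add_le_add_left (add_le_add_left (add_le_add_left hF _) _) _).trans
      (le_of_eq ?_))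
    simp only [hG]
    ring
  calc ∫⁻ ω, ENNReal.ofReal (-X ω) ∂ R
      = ∫⁻ ω, Z ω * (W ω * ENNReal.ofReal (-X ω)) ∂P₀ := (hWQ _ hXm.neg.ennreal_ofReal).symm
    _ ≤ _ := lintegral_mono_ae hpt
    _ = _ := by
      have e1 : Measurable fun ω => Z ω * (W ω * ENNReal.ofReal (X ω)) :=
        hZm.mul (hWm.mul hXm.ennreal_ofReal)
      have e2 : Measurable fun ω => Z ω * φ₁ (W ω).toReal := hZm.mul hmW
      have e3 : Measurable fun ω => ENNReal.ofReal lam * φ₂ (Z ω).toReal := hmZ.const_mul _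
      have e4 : Measurable fun ω => Z ω * ENNReal.ofReal |θ₁| := hZm.mul_const _
      have e12 : Measurable fun ω =>
          Z ω * (W ω * ENNReal.ofReal (X ω)) + Z ω * φ₁ (W ω).toReal := e1.add e2
      have e123 : Measurable fun ω => Z ω * (W ω * ENNReal.ofReal (X ω))
          + Z ω * φ₁ (W ω).toReal + ENNReal.ofReal lam * φ₂ (Z ω).toReal := e12.add e3
      have eG : Measurable fun ω => G ω + Z ω * ENNReal.ofReal |θ₁| := hGm.add e4
      rw [lintegral_add_left e123, lintegral_add_left e12,
        lintegral_add_left e1, lintegral_add_left eG, lintegral_add_left hGm,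
        lintegral_const_mul _ hmZ, hWQ _ hXm.ennreal_ofReal, ← hI₁, ← hI₂,
        hWQ _ measurable_const, lintegral_rnDeriv_mul hQ aemeasurable_const]
      simp

/-- The additive hypothesis makes sense with infinite terms. If the positive part or the divergence
is infinite the objective is `⊥`; otherwise the negative part is finite too and real subtraction
applies. -/
theorem oceObjective_le {Ω : Type*} [MeasurableSpace Ω] {R Q : Measure Ω} {X : Ω → ℝ}
    {φ : ℝ → ℝ≥0∞} {K : ℝ≥0∞} (hK : K ≠ ⊤)
    (h : ∫⁻ ω, ENNReal.ofReal (-X ω) ∂ R ≤ ∫⁻ ω, ENNReal.ofReal (X ω) ∂ R + divergence φ R Q + K) :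
    oceObjective φ X R Q ≤ (K : EReal) := by
  unfold oceObjective extIntegral
  have e1 : ∀ ω, ((X ω : ℝ) : EReal).toENNReal = ENNReal.ofReal (X ω) := fun ω => by simp
  have e2 : ∀ ω, (-((X ω : ℝ) : EReal)).toENNReal = ENNReal.ofReal (-X ω) := fun ω => by
    rw [← EReal.coe_neg]; simp
  simp only [e1, e2]
  set a := ∫⁻ ω, ENNReal.ofReal (X ω) ∂ R
  set b := ∫⁻ ω, ENNReal.ofReal (-X ω) ∂ R
  set d := divergence φ R Q
  split_ifs with ha
  · simp
  by_cases hd : d = ⊤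
  · simp [hd]
  have hb : b ≠ ⊤ := ne_top_of_le_ne_top (by finiteness) h
  rw [coe_toReal_ennreal ha, coe_toReal_ennreal hb, coe_toReal_ennreal hd, coe_toReal_ennreal hK]
  have h' := ENNReal.toReal_mono (by finiteness) h
  rw [ENNReal.toReal_add (by finiteness) hK, ENNReal.toReal_add ha hd] at h'
  norm_cast
  linarith

theorem rhoS_lt_top_of_lintegral {Ω : Type*} [MeasurableSpace Ω] {P₀ : Measure Ω}
    [IsProbabilityMeasure P₀] {X : Ω → ℝ} (hXm : Measurable X)
    {φ₁ φ₂ : ℝ → ℝ≥0∞} (hm₁ : Measurable φ₁) (hm₂ : Measurable φ₂)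
    (h₁ : effDom φ₁ ⊆ Set.Ici 0) (h₂ : effDom φ₂ ⊆ Set.Ici 0) (r : ℝ)
    {lam : ℝ} (hlam : 0 ≤ lam) {θ₁ θ₂ : ℝ}
    (hfin : ∫⁻ ω, (scaledConj φ₂ lam
      (conj φ₁ ((θ₂ - X ω : ℝ) : EReal) + (θ₁ : EReal))).toENNReal ∂P₀ < ⊤) :
    rhoS φ₁ φ₂ r P₀ X < ⊤ := by
  set C := ∫⁻ ω, (scaledConj φ₂ lam
      (conj φ₁ ((θ₂ - X ω : ℝ) : EReal) + (θ₁ : EReal))).toENNReal ∂P₀ with hC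
  set K : ℝ≥0∞ := ENNReal.ofReal lam * ENNReal.ofReal r
    + (C + ENNReal.ofReal |θ₁| + ENNReal.ofReal |θ₂|) with hK
  have hKtop : K ≠ ⊤ := by
    have := hfin.ne
    finiteness
  have hle : rhoS φ₁ φ₂ r P₀ X ≤ (K : EReal) := by
    refine iSup_le fun Q => iSup_le fun hQr => iSup_le fun R => iSup_le fun hR => ?_
    have hQ : (Q : Measure Ω) ≪ P₀ := by
      by_contra hcon
      simp [divergence, hcon] at hQr
    refine oceObjective_le hKtop ((lintegral_neg_le hQ hR hXm hm₁ hm₂ h₁ h₂ hlam θ₁ θ₂).trans ?_)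
    rw [hK, ← add_assoc (_ + _) (_ * _)]
    gcongr
  refine hle.trans_lt ?_
  rw [coe_toReal_ennreal hKtop]
  exact EReal.coe_lt_top _

theorem rhoL_lt_top_of_lintegral {Ω : Type*} [MeasurableSpace Ω] {P₀ : Measure Ω}
    [IsProbabilityMeasure P₀] {X : Ω → ℝ} (hXm : Measurable X)
    {φ₁ φ₂ : ℝ → ℝ≥0∞} (hm₁ : Measurable φ₁) (hm₂ : Measurable φ₂)
    (h₁ : effDom φ₁ ⊆ Set.Ici 0) (h₂ : effDom φ₂ ⊆ Set.Ici 0) {θ₁ θ₂ : ℝ}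
    (hfin : ∫⁻ ω, (scaledConj φ₂ 1
      (conj φ₁ ((θ₂ - X ω : ℝ) : EReal) + (θ₁ : EReal))).toENNReal ∂P₀ < ⊤) :
    rhoL φ₁ φ₂ P₀ X < ⊤ := by
  set C := ∫⁻ ω, (scaledConj φ₂ 1
      (conj φ₁ ((θ₂ - X ω : ℝ) : EReal) + (θ₁ : EReal))).toENNReal ∂P₀ with hC
  set K : ℝ≥0∞ := C + ENNReal.ofReal |θ₁| + ENNReal.ofReal |θ₂| with hK
  have hKtop : K ≠ ⊤ := by
    have := hfin.ne
    finiteness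
  have hle : rhoL φ₁ φ₂ P₀ X ≤ (K : EReal) := by
    refine iSup_le fun Q => iSup_le fun hQ => iSup_le fun R => iSup_le fun hR => ?_
    by_cases hd : divergence φ₂ (Q : Measure Ω) P₀ = ⊤
    · simp [hd]
    -- The second divergence is kept inside the constant, so that the penalty of `rhoL` cancels it.
    have hle := oceObjective_le (φ := φ₁) (X := X) (R := (R : Measure Ω)) (Q := (Q : Measure Ω))
      (K := divergence φ₂ (Q : Measure Ω) P₀ + K) (by finiteness) (by
        refine (lintegral_neg_le hQ hR hXm hm₁ hm₂ h₁ h₂ zero_le_one θ₁ θ₂).trans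
          (le_of_eq ?_)
        rw [ENNReal.ofReal_one, one_mul, ← add_assoc (_ + _) (divergence φ₂ _ _)])
    refine (EReal.sub_le_sub hle le_rfl).trans (le_of_eq ?_)
    rw [EReal.coe_ennreal_add, coe_toReal_ennreal hd, coe_toReal_ennreal hKtop]
    norm_cast
    ring
  refine hle.trans_lt ?_
  rw [coe_toReal_ennreal hKtop]
  exact EReal.coe_lt_top _

/-! ### Separation in finite dimensions and convexity of the penalties. -/

/-- A convex set which is downward closed in its last coordinate, contains a piece of a horizontal
hyperplane around `x₀` and is bounded above over `x₀`, lies below the graph of a continuous affine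
function. -/
theorem exists_affine_bound {E : Type*} [NormedAddCommGroup E] [NormedSpace ℝ E]
    {A : Set (E × ℝ)} (hA : Convex ℝ A) (hdown : ∀ x t t', (x, t) ∈ A → t' ≤ t → (x, t') ∈ A)
    {x₀ : E} {M c : ℝ} (hub : ∀ t, (x₀, t) ∈ A → t ≤ M) (hnb : ∀ᶠ x in 𝓝 x₀, (x, c) ∈ A) :
    ∃ (f : E →L[ℝ] ℝ) (C : ℝ), ∀ x t, (x, t) ∈ A → t ≤ f x + C := by
  -- Dropping strictly below height `c` leaves vertical room, so downward closure yields an interior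
  -- point.
  have hmem : ∀ᶠ p : E × ℝ in 𝓝 (x₀, c - 1), p ∈ A := by
    rw [nhds_prod_eq]
    filter_upwards [hnb.prod_mk (Iio_mem_nhds (show c - 1 < c by linarith))] with p hp
    exact hdown p.1 c p.2 hp.1 hp.2.le
  have hint : (interior A).Nonempty := ⟨(x₀, c - 1), mem_interior_iff_mem_nhds.2 hmem⟩
  have hnot : (x₀, M + 1) ∉ interior A := fun h => by
    have := hub _ (interior_subset h)
    linarith
  obtain ⟨F, hF0, hF⟩ := geometric_hahn_banach_of_nonempty_interior_point hA hnot hint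
  set g : E →L[ℝ] ℝ := F.comp (ContinuousLinearMap.inl ℝ E ℝ) with hg
  set τ : ℝ := F (0, 1) with hτ
  have hsplit : ∀ x t, F (x, t) = g x + τ * t := by
    intro x t
    have : ((x, t) : E × ℝ) = (x, 0) + t • ((0, 1) : E × ℝ) := by simp
    rw [this, map_add, map_smul]
    simp [hg, hτ, mul_comm]
  have hF' : ∀ x t, (x, t) ∈ A → g x + τ * t ≤ g x₀ + τ * (M + 1) := by
    intro x t h
    rw [← hsplit, ← hsplit]
    exact hF _ h
  have hxc : (x₀, c) ∈ A := hnb.self_of_nhds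
  have hcM : c ≤ M := hub c hxc
  have hτ0 : 0 ≤ τ := by
    have := hF' x₀ c hxc
    nlinarith
  -- A vertical hyperplane is excluded by Slater's condition: with `τ = 0`, `g` would have a local
  -- maximum at `x₀`, hence vanish, and so would `F`.
  have hτpos : 0 < τ := by
    refine lt_of_le_of_ne hτ0 fun h0 => hF0 ?_
    have hle : ∀ᶠ x in 𝓝 x₀, g x ≤ g x₀ := by
      filter_upwards [hnb] with x hx
      simpa [← h0] using hF' x c hx
    have hg0 : g = 0 := by
      have hloc : IsLocalMax g x₀ := hle
      have := hloc.fderiv_eq_zero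
      rwa [g.fderiv] at this
    ext p
    · simpa [hg] using congrArg (fun k : E →L[ℝ] ℝ => k _) hg0
    · simpa using h0.symm
  refine ⟨-(τ⁻¹ • g), τ⁻¹ * (g x₀ + τ * (M + 1)), fun x t h => ?_⟩
  have h1 := mul_le_mul_of_nonneg_left (hF' x t h) (inv_nonneg.2 hτ0)
  have h2 : τ⁻¹ * (g x + τ * t) = τ⁻¹ * g x + t := by field_simp
  simp only [neg_apply, smul_apply, smul_eq_mul]
  linarith

theorem le_of_convexOn {φ : ℝ → ℝ≥0∞} (h : ConvexOn ℝ≥0 Set.univ φ) (x y : ℝ) {s t : ℝ}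
    (hs : 0 ≤ s) (ht : 0 ≤ t) (hst : s + t = 1) :
    φ (s * x + t * y) ≤ ENNReal.ofReal s * φ x + ENNReal.ofReal t * φ y := by
  lift s to ℝ≥0 using hs
  lift t to ℝ≥0 using ht
  rw [ENNReal.ofReal_coe_nnreal, ENNReal.ofReal_coe_nnreal]
  exact h.2 (Set.mem_univ x) (Set.mem_univ y) (zero_le (a := s)) (zero_le (a := t))
    (by exact_mod_cast hst)

/-- Elements of `Phi0` are continuous at `1`. -/
theorem eventually_le_of_mem_Phi0 {φ : ℝ → ℝ≥0∞} (h : φ ∈ Phi0) {ε : ℝ} (hε : 0 < ε) :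
    ∀ᶠ t in 𝓝 (1 : ℝ), φ t ≤ ENNReal.ofReal ε := by
  obtain ⟨hc, h1, -, hnb⟩ := h
  obtain ⟨δ, hδ, hball⟩ := Metric.nhds_basis_closedBall.mem_iff.1 hnb
  have hp : φ (1 + δ) < ⊤ := hball (show (1 + δ : ℝ) ∈ _ by
    simp [abs_of_pos hδ])
  have hm : φ (1 - δ) < ⊤ := hball (show (1 - δ : ℝ) ∈ _ by
    simp [abs_of_pos hδ])
  set K := φ (1 + δ) + φ (1 - δ) with hK
  have hKtop : K ≠ ⊤ := ENNReal.add_ne_top.2 ⟨hp.ne, hm.ne⟩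
  -- On each side of `1` the graph lies below the chord from `(1, 0)` to the value at `1 ± δ`.
  have hle : ∀ᶠ t in 𝓝 (1 : ℝ), φ t ≤ ENNReal.ofReal (|t - 1| / δ) * K := by
    filter_upwards [Metric.closedBall_mem_nhds (1 : ℝ) hδ] with t ht
    rw [Metric.mem_closedBall, Real.dist_eq] at ht
    have hs0 : 0 ≤ |t - 1| / δ := by positivity
    have hs1 : |t - 1| / δ ≤ 1 := (div_le_one hδ).2 ht
    rcases le_total 1 t with h | h
    · have := le_of_convexOn hc 1 (1 + δ) (sub_nonneg.2 hs1) hs0 (by ring)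
      rw [h1, mul_zero, zero_add] at this
      rw [show (1 - |t - 1| / δ) * 1 + |t - 1| / δ * (1 + δ) = t by
        rw [abs_of_nonneg (by linarith)]; field_simp; ring] at this
      exact this.trans (by gcongr; exact le_self_add)
    · have := le_of_convexOn hc 1 (1 - δ) (sub_nonneg.2 hs1) hs0 (by ring)
      rw [h1, mul_zero, zero_add] at this
      rw [show (1 - |t - 1| / δ) * 1 + |t - 1| / δ * (1 - δ) = t by
        rw [abs_of_nonpos (by linarith)]; field_simp; ring] at this
      exact this.trans (by gcongr; exact le_add_self)
  have hlim : Filter.Tendsto (fun t : ℝ => ENNReal.ofReal (|t - 1| / δ) * K) (𝓝 1) (𝓝 0) := by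
    have hcont : Continuous fun t : ℝ => ENNReal.ofReal (|t - 1| / δ) :=
      ENNReal.continuous_ofReal.comp (by fun_prop)
    have := ENNReal.Tendsto.mul_const (hcont.tendsto 1) (Or.inr hKtop)
    simpa using this
  filter_upwards [hle, hlim.eventually (gt_mem_nhds (ENNReal.ofReal_pos.2 hε))] with t h1 h2
  exact h1.trans h2.le

/-- The quadruples `(v, z, a, b)` with `z > 0` such that `a` dominates the perspective
`z φ₁ (v / z)` and `b` dominates `φ₂ z`. -/
def penaltyEpigraph (φ₁ φ₂ : ℝ → ℝ≥0∞) : Set (ℝ × ℝ × ℝ × ℝ) :=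
  {y | 0 < y.2.1 ∧ 0 ≤ y.2.2.1 ∧ 0 ≤ y.2.2.2 ∧
    ENNReal.ofReal y.2.1 * φ₁ (y.1 / y.2.1) ≤ ENNReal.ofReal y.2.2.1 ∧
    φ₂ y.2.1 ≤ ENNReal.ofReal y.2.2.2}

/-- The perspective of a convex function is convex: `(s v + t v') / Z` is the average of `v / z` and
`v' / z'` with weights `s z / Z` and `t z' / Z`. -/
theorem convex_penaltyEpigraph {φ₁ φ₂ : ℝ → ℝ≥0∞} (h₁ : ConvexOn ℝ≥0 Set.univ φ₁)
    (h₂ : ConvexOn ℝ≥0 Set.univ φ₂) : Convex ℝ (penaltyEpigraph φ₁ φ₂) := by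
  rintro ⟨v, z, a, b⟩ ⟨hz, ha, hb, hφ₁, hφ₂⟩ ⟨v', z', a', b'⟩ ⟨hz', ha', hb', hφ₁', hφ₂'⟩
    s t hs ht hst
  simp only at hz ha hb hφ₁ hφ₂ hz' ha' hb' hφ₁' hφ₂'
  have hZ : 0 < s * z + t * z' := by
    rcases hs.eq_or_lt with rfl | hs
    · rw [zero_add] at hst
      simpa [hst] using hz'
    · exact add_pos_of_pos_of_nonneg (mul_pos hs hz) (mul_nonneg ht hz'.le)
  refine ⟨by simpa using hZ, by simpa using by positivity, by simpa using by positivity, ?_, ?_⟩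
  · simp only [Prod.smul_mk, Prod.mk_add_mk, smul_eq_mul]
    set Z := s * z + t * z' with hZdef
    have hc := le_of_convexOn h₁ (v / z) (v' / z') (s := s * z / Z) (t := t * z' / Z)
      (by positivity) (by positivity) (by rw [← add_div]; exact div_self hZ.ne')
    rw [show s * z / Z * (v / z) + t * z' / Z * (v' / z') = (s * v + t * v') / Z by
      field_simp] at hc
    calc ENNReal.ofReal Z * φ₁ ((s * v + t * v') / Z)
        ≤ ENNReal.ofReal Z * (ENNReal.ofReal (s * z / Z) * φ₁ (v / z)
          + ENNReal.ofReal (t * z' / Z) * φ₁ (v' / z')) := by gcongr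
      _ = ENNReal.ofReal s * (ENNReal.ofReal z * φ₁ (v / z))
          + ENNReal.ofReal t * (ENNReal.ofReal z' * φ₁ (v' / z')) := by
        rw [mul_add, ← mul_assoc, ← mul_assoc, ← mul_assoc, ← mul_assoc,
          ← ENNReal.ofReal_mul hZ.le, ← ENNReal.ofReal_mul hZ.le, ← ENNReal.ofReal_mul hs,
          ← ENNReal.ofReal_mul ht, mul_div_cancel₀ _ hZ.ne', mul_div_cancel₀ _ hZ.ne']
      _ ≤ ENNReal.ofReal s * ENNReal.ofReal a + ENNReal.ofReal t * ENNReal.ofReal a' := by gcongr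
      _ = ENNReal.ofReal (s * a + t * a') := by
        rw [← ENNReal.ofReal_mul hs, ← ENNReal.ofReal_mul ht,
          ENNReal.ofReal_add (by positivity) (by positivity)]
  · simp only [Prod.smul_mk, Prod.mk_add_mk, smul_eq_mul]
    refine (le_of_convexOn h₂ z z' hs ht hst).trans ?_
    rw [ENNReal.ofReal_add (by positivity) (by positivity), ENNReal.ofReal_mul hs,
      ENNReal.ofReal_mul ht]
    gcongr

/-! ### The moment problem over simple functions. -/

variable {Ω : Type*} [MeasurableSpace Ω] {P₀ : Measure Ω} {X : Ω → ℝ}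

theorem integrable_simpleFunc_comp (P₀ : Measure Ω) [IsProbabilityMeasure P₀]
    (Y : SimpleFunc Ω (ℝ × ℝ × ℝ × ℝ)) (f : ℝ × ℝ × ℝ × ℝ → ℝ) :
    Integrable (fun ω => f (Y ω)) P₀ :=
  (Y.map f).integrable_of_isFiniteMeasure

/-- Simple functions are bounded, so `X ∈ L¹` is enough for every moment to be finite. -/
theorem integrable_mul_simpleFunc_comp (hX : Integrable X P₀)
    (Y : SimpleFunc Ω (ℝ × ℝ × ℝ × ℝ)) (f : ℝ × ℝ × ℝ × ℝ → ℝ) :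
    Integrable (fun ω => X ω * f (Y ω)) P₀ := by
  obtain ⟨B, hB⟩ := (Y.map f).exists_forall_norm_le
  exact hX.mul_bdd (c := B) (Y.map f).stronglyMeasurable.aestronglyMeasurable
    (Filter.Eventually.of_forall hB)

variable [IsProbabilityMeasure P₀]

/-- The moments `((E V, E Z, E b), E [-X V] - E a)` of a simple function `(V, Z, a, b)`. -/
noncomputable def moments (hX : Integrable X P₀) :
    SimpleFunc Ω (ℝ × ℝ × ℝ × ℝ) →ₗ[ℝ] (ℝ × ℝ × ℝ) × ℝ where
  toFun Y := ((∫ ω, (Y ω).1 ∂P₀, ∫ ω, (Y ω).2.1 ∂P₀, ∫ ω, (Y ω).2.2.2 ∂P₀),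
    -(∫ ω, X ω * (Y ω).1 ∂P₀) - ∫ ω, (Y ω).2.2.1 ∂P₀)
  map_add' Y Y' := by
    have i := fun (Y : SimpleFunc Ω (ℝ × ℝ × ℝ × ℝ)) f => integrable_simpleFunc_comp P₀ Y f
    simp only [SimpleFunc.coe_add, Pi.add_apply, Prod.fst_add, Prod.snd_add, Prod.mk_add_mk,
      mul_add]
    rw [integral_add (i Y fun y => y.1) (i Y' fun y => y.1),
      integral_add (i Y fun y => y.2.1) (i Y' fun y => y.2.1),
      integral_add (i Y fun y => y.2.2.1) (i Y' fun y => y.2.2.1),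
      integral_add (i Y fun y => y.2.2.2) (i Y' fun y => y.2.2.2),
      integral_add (integrable_mul_simpleFunc_comp hX Y fun y => y.1)
        (integrable_mul_simpleFunc_comp hX Y' fun y => y.1)]
    congr 1
    ring
  map_smul' s Y := by
    simp only [SimpleFunc.coe_smul, Pi.smul_apply, Prod.smul_fst, Prod.smul_snd, smul_eq_mul,
      mul_left_comm _ s, integral_const_mul, RingHom.id_apply, Prod.smul_mk]
    congr 1
    ring

/-- The simple functions with values in the penalty epigraph. -/
def admissible (Ω : Type*) [MeasurableSpace Ω] (φ₁ φ₂ : ℝ → ℝ≥0∞) :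
    Set (SimpleFunc Ω (ℝ × ℝ × ℝ × ℝ)) :=
  {Y | ∀ ω, Y ω ∈ penaltyEpigraph φ₁ φ₂}

variable {φ₁ φ₂ : ℝ → ℝ≥0∞}

theorem convex_moments_image (hX : Integrable X P₀) (h₁ : φ₁ ∈ Phi0) (h₂ : φ₂ ∈ Phi0) :
    Convex ℝ (moments hX '' admissible Ω φ₁ φ₂) := by
  refine Convex.linear_image (fun Y hY Y' hY' s t hs ht hst ω => ?_) _
  exact convex_penaltyEpigraph h₁.1 h₂.1 (hY ω) (hY' ω) hs ht hst

/-- Moments can be relaxed by raising the penalties. -/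
theorem moments_image_relax (hX : Integrable X P₀) {m n u u' t t' : ℝ}
    (h : ((m, n, u), t) ∈ moments hX '' admissible Ω φ₁ φ₂) (hu : u ≤ u') (ht : t' ≤ t) :
    ((m, n, u'), t') ∈ moments hX '' admissible Ω φ₁ φ₂ := by
  obtain ⟨Y, hY, hYm⟩ := h
  refine ⟨Y + SimpleFunc.const Ω (0, 0, t - t', u' - u), fun ω => ?_, ?_⟩
  · obtain ⟨hz, ha, hb, h1, h2⟩ := hY ω
    refine ⟨by simpa using hz, by simpa using by linarith, by simpa using by linarith, ?_, ?_⟩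
    · simpa using h1.trans (ENNReal.ofReal_le_ofReal (by linarith))
    · simpa using h2.trans (ENNReal.ofReal_le_ofReal (by linarith))
  · rw [map_add, hYm]
    simp [moments]

/-- Slater's condition for the moment problem. -/
theorem exists_eventually_mem_moments_image (hX : Integrable X P₀) (h₁ : φ₁ ∈ Phi0)
    (h₂ : φ₂ ∈ Phi0) {r : ℝ} (hr : 0 < r) :
    ∃ c : ℝ, ∀ᶠ p : ℝ × ℝ × ℝ in 𝓝 (1, 1, r),
      (p, c) ∈ moments hX '' admissible Ω φ₁ φ₂ := by
  set e : ℝ := ∫ ω, X ω ∂P₀ with he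
  -- With constants `(m, n, a, u)` the objective is `-(e * m) - a`. For `m, n < 2` and `φ₁ (m / n) ≤
  -- 1`, the choice of `a` giving this value satisfies `a ≥ 2 ≥ n φ₁ (m / n)`.
  refine ⟨-2 * |e| - 2, ?_⟩
  have c1 : ContinuousAt (fun p : ℝ × ℝ × ℝ => p.1) (1, 1, r) := by fun_prop
  have c2 : ContinuousAt (fun p : ℝ × ℝ × ℝ => p.2.1) (1, 1, r) := by fun_prop
  have c3 : ContinuousAt (fun p : ℝ × ℝ × ℝ => p.2.2) (1, 1, r) := by fun_prop
  have c4 : ContinuousAt (fun p : ℝ × ℝ × ℝ => p.1 / p.2.1) (1, 1, r) :=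
    c1.div c2 (by norm_num)
  have t4 : Filter.Tendsto (fun p : ℝ × ℝ × ℝ => p.1 / p.2.1) (𝓝 (1, 1, r)) (𝓝 1) := by
    simpa [ContinuousAt] using c4
  filter_upwards [c2.tendsto.eventually (eventually_le_of_mem_Phi0 h₂ (half_pos hr)),
    t4.eventually (eventually_le_of_mem_Phi0 h₁ one_pos),
    c1.tendsto.eventually (Ioo_mem_nhds (show (0 : ℝ) < 1 by norm_num) one_lt_two),
    c2.tendsto.eventually (Ioo_mem_nhds (show (0 : ℝ) < 1 by norm_num) one_lt_two),
    c3.tendsto.eventually (lt_mem_nhds (half_lt_self hr))]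
  rintro ⟨m, n, u⟩ hφ₂ hφ₁ ⟨hm0, hm2⟩ ⟨hn0, hn2⟩ hu
  simp only at hφ₂ hφ₁ hm0 hm2 hn0 hn2 hu
  have ha : 2 ≤ -(e * m) + 2 * |e| + 2 := by nlinarith [le_abs_self e, abs_nonneg e]
  refine ⟨SimpleFunc.const Ω (m, n, -(e * m) + 2 * |e| + 2, u), fun ω => ?_, ?_⟩
  · refine ⟨hn0, by simpa using by linarith, by simpa using by linarith, ?_,
      hφ₂.trans (ENNReal.ofReal_le_ofReal hu.le)⟩
    calc ENNReal.ofReal n * φ₁ (m / n) ≤ ENNReal.ofReal n * ENNReal.ofReal 1 := by gcongr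
      _ = ENNReal.ofReal n := by simp
      _ ≤ _ := ENNReal.ofReal_le_ofReal (by simpa using by linarith)
  · simp only [moments, LinearMap.coe_mk, AddHom.coe_mk, SimpleFunc.coe_const, Function.const_apply,
      integral_const, integral_mul_const, ← he, probReal_univ, one_smul]
    congr 1
    ring

theorem extIntegral_coe_of_integrable {μ : Measure Ω} (h : Integrable X μ) :
    extIntegral μ (fun ω => (X ω : EReal)) = ((∫ ω, X ω ∂μ : ℝ) : EReal) := by
  have e1 : ∀ ω, ((X ω : ℝ) : EReal).toENNReal = ENNReal.ofReal (X ω) := fun ω => by simp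
  have e2 : ∀ ω, (-((X ω : ℝ) : EReal)).toENNReal = ENNReal.ofReal (-X ω) := fun ω => by
    rw [← EReal.coe_neg]; simp
  have f1 : ∫⁻ ω, ENNReal.ofReal (X ω) ∂μ ≠ ⊤ := by
    simpa using h.lintegral_lt_top.ne
  have f2 : ∫⁻ ω, ENNReal.ofReal (-X ω) ∂μ ≠ ⊤ := by
    simpa using h.neg.lintegral_lt_top.ne
  simp only [extIntegral, e1, e2, if_neg f1]
  rw [coe_toReal_ennreal f1, coe_toReal_ennreal f2, ← EReal.coe_sub,
    integral_eq_lintegral_pos_part_sub_lintegral_neg_part h]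

/-- An admissible simple function with unit moments gives a pair of probability measures. -/
theorem exists_probabilityMeasures (hX : Integrable X P₀) (hm₁ : Measurable φ₁)
    (h₁ : φ₁ ∈ Phi0) {u t : ℝ}
    (h : ((1, 1, u), t) ∈ moments hX '' admissible Ω φ₁ φ₂) :
    ∃ Q R : ProbabilityMeasure Ω, (Q : Measure Ω) ≪ P₀ ∧ (R : Measure Ω) ≪ (Q : Measure Ω) ∧
      divergence φ₂ (Q : Measure Ω) P₀ ≤ ENNReal.ofReal u ∧
      (t : EReal) ≤ oceObjective φ₁ X (R : Measure Ω) (Q : Measure Ω) := by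
  obtain ⟨Y, hY, hYm⟩ := h
  simp only [moments, LinearMap.coe_mk, AddHom.coe_mk, Prod.mk.injEq] at hYm
  obtain ⟨⟨hV1, hZ1, hu⟩, ht⟩ := hYm
  have i := integrable_simpleFunc_comp P₀ Y
  set V : Ω → ℝ := fun ω => (Y ω).1 with hV
  set Z : Ω → ℝ := fun ω => (Y ω).2.1 with hZ
  have hVm : Measurable V := Y.measurable.fst
  have hZm : Measurable Z := Y.measurable.snd.fst
  have hZ0 : ∀ ω, 0 < Z ω := fun ω => (hY ω).1
  -- Nonnegativity of the density is forced by finiteness of the `φ₁` penalty.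
  have hW0 : ∀ ω, 0 ≤ V ω / Z ω := fun ω => by
    refine nonneg_of_ne_top h₁.2.2.1 fun htop => ?_
    have := (hY ω).2.2.2.1
    rw [show (Y ω).1 / (Y ω).2.1 = V ω / Z ω from rfl, htop,
      ENNReal.mul_top (ENNReal.ofReal_pos.2 (hZ0 ω)).ne'] at this
    exact ENNReal.ofReal_ne_top (top_le_iff.1 this)
  have hV0 : ∀ ω, 0 ≤ V ω := fun ω => by
    have := mul_nonneg (hW0 ω) (hZ0 ω).le
    rwa [div_mul_cancel₀ _ (hZ0 ω).ne'] at this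
  set dZ : Ω → ℝ≥0∞ := fun ω => ENNReal.ofReal (Z ω) with hdZ
  set dW : Ω → ℝ≥0∞ := fun ω => ENNReal.ofReal (V ω / Z ω) with hdW
  set dV : Ω → ℝ≥0∞ := fun ω => ENNReal.ofReal (V ω) with hdV
  have hdZm : Measurable dZ := hZm.ennreal_ofReal
  have hdWm : Measurable dW := (hVm.div hZm).ennreal_ofReal
  have hdVm : Measurable dV := hVm.ennreal_ofReal
  set Q := P₀.withDensity dZ with hQ
  set R := Q.withDensity dW with hR
  have hRV : R = P₀.withDensity dV := by
    rw [hR, hQ, ← withDensity_mul _ hdZm hdWm]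
    congr 1
    ext ω
    simp only [Pi.mul_apply, hdZ, hdW, hdV]
    rw [← ENNReal.ofReal_mul (hZ0 ω).le, mul_div_cancel₀ _ (hZ0 ω).ne']
  have hQP : IsProbabilityMeasure Q := ⟨by
    rw [hQ, withDensity_apply _ MeasurableSet.univ, Measure.restrict_univ,
      ← ofReal_integral_eq_lintegral_ofReal (i fun y => y.2.1)
        (Filter.Eventually.of_forall fun ω => (hZ0 ω).le), hZ1, ENNReal.ofReal_one]⟩
  have hRP : IsProbabilityMeasure R := ⟨by
    rw [hRV, withDensity_apply _ MeasurableSet.univ, Measure.restrict_univ,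
      ← ofReal_integral_eq_lintegral_ofReal (i fun y => y.1)
        (Filter.Eventually.of_forall fun ω => hV0 ω), hV1, ENNReal.ofReal_one]⟩
  have hQac : Q ≪ P₀ := withDensity_absolutelyContinuous _ _
  have hRac : R ≪ Q := withDensity_absolutelyContinuous _ _
  refine ⟨⟨Q, hQP⟩, ⟨R, hRP⟩, hQac, hRac, ?_, ?_⟩
  · change divergence φ₂ Q P₀ ≤ _
    rw [divergence, if_pos hQac, ← hu, ofReal_integral_eq_lintegral_ofReal (i fun y => y.2.2.2)
      (Filter.Eventually.of_forall fun ω => (hY ω).2.2.1)]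
    refine lintegral_mono_ae ?_
    filter_upwards [Measure.rnDeriv_withDensity P₀ hdZm] with ω hω
    rw [hω, hdZ, ENNReal.toReal_ofReal (hZ0 ω).le]
    exact (hY ω).2.2.2.2
  · change _ ≤ oceObjective φ₁ X R Q
    have hdiv : divergence φ₁ R Q ≤ ENNReal.ofReal (∫ ω, (Y ω).2.2.1 ∂P₀) := by
      rw [divergence, if_pos hRac,
        ofReal_integral_eq_lintegral_ofReal (i fun y => y.2.2.1)
          (Filter.Eventually.of_forall fun ω => (hY ω).2.1)]
      calc ∫⁻ ω, φ₁ (R.rnDeriv Q ω).toReal ∂Q = ∫⁻ ω, φ₁ (V ω / Z ω) ∂Q := by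
            refine lintegral_congr_ae ?_
            filter_upwards [Measure.rnDeriv_withDensity Q hdWm] with ω hω
            rw [hω, hdW, ENNReal.toReal_ofReal (hW0 ω)]
        _ = ∫⁻ ω, dZ ω * φ₁ (V ω / Z ω) ∂P₀ := by
            exact lintegral_withDensity_eq_lintegral_mul _ hdZm (hm₁.comp (hVm.div hZm))
        _ ≤ _ := lintegral_mono fun ω => (hY ω).2.2.2.1
    have hsm : (fun ω => (dV ω).toReal • X ω) = fun ω => X ω * V ω := by
      ext ω
      rw [hdV, ENNReal.toReal_ofReal (hV0 ω), smul_eq_mul, mul_comm]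
    have hdVtop : ∀ᵐ ω ∂P₀, dV ω < ⊤ := Filter.Eventually.of_forall fun ω => ENNReal.ofReal_lt_top
    have hXR : Integrable X R := by
      rw [hRV, integrable_withDensity_iff_integrable_smul' hdVm hdVtop, hsm]
      exact integrable_mul_simpleFunc_comp hX Y fun y => y.1
    have hXi : ∫ ω, X ω ∂ R = ∫ ω, X ω * V ω ∂P₀ := by
      rw [hRV, integral_withDensity_eq_integral_toReal_smul hdVm hdVtop, hsm]
    rw [oceObjective, extIntegral_coe_of_integrable hXR, hXi, ← ht]
    have ha0 : 0 ≤ ∫ ω, (Y ω).2.2.1 ∂P₀ := integral_nonneg fun ω => (hY ω).2.1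
    have hdiv' : ((divergence φ₁ R Q : ℝ≥0∞) : EReal)
        ≤ ((∫ ω, (Y ω).2.2.1 ∂P₀ : ℝ) : EReal) := by
      refine (EReal.coe_ennreal_le_coe_ennreal_iff.2 hdiv).trans (le_of_eq ?_)
      rw [coe_toReal_ennreal ENNReal.ofReal_ne_top, ENNReal.toReal_ofReal ha0]
    rw [EReal.coe_sub, EReal.coe_neg]
    exact EReal.sub_le_sub le_rfl hdiv'

/-! ### Exchange of supremum and integral. -/

/-- An upper bound for the Lagrangian over admissible simple functions makes the positive part of
the composed conjugate integrable. -/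
theorem lintegral_scaledConj_lt_top (hXm : Measurable X) (hX : Integrable X P₀)
    (h₁ : φ₁ ∈ Phi0) (h₂ : φ₂ ∈ Phi0) {θ₁ θ₂ lam C : ℝ} (hlam : 0 < lam)
    (hC : ∀ Y ∈ admissible Ω φ₁ φ₂, ∫ ω, ((θ₂ - X ω) * (Y ω).1 + θ₁ * (Y ω).2.1
      - (Y ω).2.2.1 - lam * (Y ω).2.2.2) ∂P₀ ≤ C) :
    ∫⁻ ω, (scaledConj φ₂ lam
      (conj φ₁ ((θ₂ - X ω : ℝ) : EReal) + (θ₁ : EReal))).toENNReal ∂P₀ < ⊤ := by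
  set D := penaltyEpigraph φ₁ φ₂ with hD
  set c : ℝ → ℝ × ℝ × ℝ × ℝ → ℝ := fun x y =>
    (θ₂ - x) * y.1 + θ₁ * y.2.1 - y.2.2.1 - lam * y.2.2.2 with hc
  have hone : ((1, 1, 0, 0) : ℝ × ℝ × ℝ × ℝ) ∈ D := by
    refine ⟨one_pos, le_rfl, le_rfl, ?_, ?_⟩
    · simp [h₁.2.1]
    · simp [h₂.2.1]
  -- Superlevel sets are open in `x`, so by the Lindelöf property countably many `y` realize the
  -- supremum at every `x` at once; this replaces measurable selection.
  have hopen : ∀ q : ℚ, ∃ T ⊆ D, T.Countable ∧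
      ⋃ y ∈ T, {x | (q : ℝ) < c x y} = ⋃ y ∈ D, {x | (q : ℝ) < c x y} := fun q =>
    TopologicalSpace.isOpen_biUnion_countable D _ fun y _ =>
      isOpen_lt continuous_const (by fun_prop)
  choose T hTD hTc hTU using hopen
  have hcount : (insert (1, 1, 0, 0) (⋃ q, T q)).Countable := (Set.countable_iUnion hTc).insert _
  obtain ⟨y, hy⟩ := hcount.exists_eq_range (Set.insert_nonempty _ _)
  have hyD : ∀ n, y n ∈ D := fun n => by
    have : y n ∈ insert (1, 1, 0, 0) (⋃ q, T q) := hy ▸ Set.mem_range_self n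
    rcases this with h | h
    · exact h ▸ hone
    · obtain ⟨q, hq⟩ := Set.mem_iUnion.1 h
      exact hTD q hq
  have hcm : ∀ Y : SimpleFunc Ω (ℝ × ℝ × ℝ × ℝ), Measurable fun ω => c (X ω) (Y ω) := fun Y => by
    have := Y.measurable
    simp only [hc]
    fun_prop
  have hci : ∀ Y : SimpleFunc Ω (ℝ × ℝ × ℝ × ℝ), Integrable (fun ω => c (X ω) (Y ω)) P₀ :=
    fun Y => by
      have := (integrable_simpleFunc_comp P₀ Y fun y =>
        θ₂ * y.1 + θ₁ * y.2.1 - y.2.2.1 - lam * y.2.2.2).sub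
        (integrable_mul_simpleFunc_comp hX Y fun y => y.1)
      refine this.congr (Filter.Eventually.of_forall fun ω => ?_)
      simp only [hc, Pi.sub_apply]
      ring
  -- Switching to the constant `y n` exactly where it does better keeps the function simple and
  -- admissible.
  have hstep : ∀ (Y : admissible Ω φ₁ φ₂) (n : ℕ), ∃ Y' : admissible Ω φ₁ φ₂, ∀ ω,
      c (X ω) (Y.1 ω) ≤ c (X ω) (Y'.1 ω) ∧ c (X ω) (y n) ≤ c (X ω) (Y'.1 ω) := by
    intro Y n
    have hs : MeasurableSet {ω | c (X ω) (Y.1 ω) < c (X ω) (y n)} :=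
      measurableSet_lt (hcm Y.1) (hcm (SimpleFunc.const Ω (y n)))
    have hcases : ∀ ω, (c (X ω) (Y.1 ω) < c (X ω) (y n) ∧
        SimpleFunc.piecewise _ hs (SimpleFunc.const Ω (y n)) Y.1 ω = y n) ∨
        (c (X ω) (y n) ≤ c (X ω) (Y.1 ω) ∧
        SimpleFunc.piecewise _ hs (SimpleFunc.const Ω (y n)) Y.1 ω = Y.1 ω) := by
      intro ω
      rw [SimpleFunc.piecewise_apply]
      by_cases h : c (X ω) (Y.1 ω) < c (X ω) (y n)
      · exact Or.inl ⟨h, if_pos h⟩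
      · exact Or.inr ⟨not_lt.1 h, if_neg h⟩
    refine ⟨⟨SimpleFunc.piecewise _ hs (SimpleFunc.const Ω (y n)) Y.1, fun ω => ?_⟩, fun ω => ?_⟩
    · rcases hcases ω with ⟨-, h⟩ | ⟨-, h⟩
      · rw [h]; exact hyD n
      · rw [h]; exact Y.2 ω
    · rcases hcases ω with ⟨h', h⟩ | ⟨h', h⟩
      · rw [h]; exact ⟨h'.le, le_rfl⟩
      · rw [h]; exact ⟨le_rfl, h'⟩
  choose step hstep using hstep
  set S : ℕ → admissible Ω φ₁ φ₂ := fun n =>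
    Nat.rec ⟨SimpleFunc.const Ω (1, 1, 0, 0), fun _ => hone⟩ (fun n Y => step Y n) n with hS
  set G : ℕ → Ω → ℝ := fun n ω => c (X ω) ((S n).1 ω) with hG
  have hGmono : ∀ ω, Monotone fun n => G n ω := fun ω =>
    monotone_nat_of_le_succ fun n => (hstep (S n) n ω).1
  have hGy : ∀ n ω, c (X ω) (y n) ≤ G (n + 1) ω := fun n ω => (hstep (S n) n ω).2
  have hGi : ∀ n, Integrable (G n) P₀ := fun n => hci _
  have hGC : ∀ n, ∫ ω, G n ω ∂P₀ ≤ C := fun n => hC _ (S n).2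
  -- Subtracting `G 0` makes the increasing sequence nonnegative for monotone convergence.
  have hsup : ∫⁻ ω, ⨆ n, ENNReal.ofReal (G n ω - G 0 ω) ∂P₀
      ≤ ENNReal.ofReal (C - ∫ ω, G 0 ω ∂P₀) := by
    have hm : ∀ n, Measurable fun ω => ENNReal.ofReal (G n ω - G 0 ω) := fun n =>
      ((hcm _).sub (hcm _)).ennreal_ofReal
    rw [lintegral_iSup hm (fun n m hnm ω => ENNReal.ofReal_le_ofReal (sub_le_sub_right (hGmono ω hnm) _))]
    refine iSup_le fun n => ?_
    have hi : Integrable (fun ω => G n ω - G 0 ω) P₀ := (hGi n).sub (hGi 0)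
    rw [← ofReal_integral_eq_lintegral_ofReal hi
      (Filter.Eventually.of_forall fun ω => sub_nonneg.2 (hGmono ω (Nat.zero_le n)))]
    refine ENNReal.ofReal_le_ofReal ?_
    rw [integral_sub (hGi n) (hGi 0)]
    exact sub_le_sub_right (hGC n) _
  have hpt : ∀ ω, (scaledConj φ₂ lam
      (conj φ₁ ((θ₂ - X ω : ℝ) : EReal) + (θ₁ : EReal))).toENNReal
      ≤ (⨆ n, ENNReal.ofReal (G n ω - G 0 ω)) + ENNReal.ofReal (G 0 ω) := by
    intro ω
    refine ENNReal.le_of_forall_nnreal_lt fun q hq => ?_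
    have hq' : ((q : ℝ) : EReal) < scaledConj φ₂ lam
        (conj φ₁ ((θ₂ - X ω : ℝ) : EReal) + (θ₁ : EReal)) := by
      by_contra hcon
      have := EReal.toENNReal_le_toENNReal (not_lt.1 hcon)
      rw [EReal.toENNReal_of_ne_top (EReal.coe_ne_top _), EReal.toReal_coe,
        ENNReal.ofReal_coe_nnreal] at this
      exact absurd hq (not_lt.2 this)
    obtain ⟨w, z, hz, hw1, hz2, hlt⟩ := exists_of_lt_scaledConj h₂.2.2.1 hlam q.2 hq'
    have hmem : (w * z, z, z * (φ₁ w).toReal, (φ₂ z).toReal) ∈ D := by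
      refine ⟨hz, mul_nonneg hz.le ENNReal.toReal_nonneg, ENNReal.toReal_nonneg, ?_, ?_⟩
      · simp only
        rw [mul_div_cancel_right₀ _ hz.ne', ENNReal.ofReal_mul hz.le, ENNReal.ofReal_toReal hw1]
      · simp only
        rw [ENNReal.ofReal_toReal hz2]
    have hlt' : (q : ℝ) < c (X ω) (w * z, z, z * (φ₁ w).toReal, (φ₂ z).toReal) := by
      refine lt_of_lt_of_eq hlt ?_
      simp only [hc]
      ring
    obtain ⟨p, hqp, hp⟩ := exists_rat_btwn hlt'
    have hX' : X ω ∈ ⋃ y ∈ T p, {x | (p : ℝ) < c x y} := by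
      rw [hTU p]
      exact Set.mem_biUnion hmem hp
    obtain ⟨y', hy', hpy⟩ := Set.mem_iUnion₂.1 hX'
    have : y' ∈ Set.range y := hy ▸ Set.mem_insert_of_mem _ (Set.mem_iUnion.2 ⟨p, hy'⟩)
    obtain ⟨n, rfl⟩ := this
    have hle : (q : ℝ) ≤ (G (n + 1) ω - G 0 ω) + G 0 ω := by
      have h3 := hGy n ω
      have h4 : (p : ℝ) < c (X ω) (y n) := hpy
      linarith
    calc (q : ℝ≥0∞) = ENNReal.ofReal q := (ENNReal.ofReal_coe_nnreal).symm
      _ ≤ ENNReal.ofReal (G (n + 1) ω - G 0 ω) + ENNReal.ofReal (G 0 ω) :=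
        (ENNReal.ofReal_le_ofReal hle).trans ENNReal.ofReal_add_le
      _ ≤ _ := by
        gcongr
        exact le_iSup (fun n => ENNReal.ofReal (G n ω - G 0 ω)) (n + 1)
  refine (lintegral_mono hpt).trans_lt ?_
  rw [lintegral_add_right _ (hcm _).ennreal_ofReal]
  exact ENNReal.add_lt_top.2 ⟨hsup.trans_lt ENNReal.ofReal_lt_top, (hGi 0).lintegral_lt_top⟩

/-! ### Necessity: multipliers from separation. -/

theorem integral_lagrangian (hX : Integrable X P₀) (Y : SimpleFunc Ω (ℝ × ℝ × ℝ × ℝ))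
    (θ₁ θ₂ lam : ℝ) :
    ∫ ω, ((θ₂ - X ω) * (Y ω).1 + θ₁ * (Y ω).2.1 - (Y ω).2.2.1 - lam * (Y ω).2.2.2) ∂P₀
      = θ₂ * (moments hX Y).1.1 + θ₁ * (moments hX Y).1.2.1 - lam * (moments hX Y).1.2.2
        + (moments hX Y).2 := by
  have i := integrable_simpleFunc_comp P₀ Y
  have e : ∀ ω, (θ₂ - X ω) * (Y ω).1 + θ₁ * (Y ω).2.1 - (Y ω).2.2.1 - lam * (Y ω).2.2.2
      = (θ₂ * (Y ω).1 + θ₁ * (Y ω).2.1 - (Y ω).2.2.1 - lam * (Y ω).2.2.2) - X ω * (Y ω).1 :=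
    fun ω => by ring
  simp only [e]
  rw [integral_sub (i fun y => θ₂ * y.1 + θ₁ * y.2.1 - y.2.2.1 - lam * y.2.2.2)
      (integrable_mul_simpleFunc_comp hX Y fun y => y.1),
    integral_sub (i fun y => θ₂ * y.1 + θ₁ * y.2.1 - y.2.2.1) (i fun y => lam * y.2.2.2),
    integral_sub (i fun y => θ₂ * y.1 + θ₁ * y.2.1) (i fun y => y.2.2.1),
    integral_add (i fun y => θ₂ * y.1) (i fun y => θ₁ * y.2.1)]
  simp only [integral_const_mul, moments, LinearMap.coe_mk, AddHom.coe_mk]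
  ring

theorem exists_lintegral_lt_top_of_rhoS (hXm : Measurable X) (hX : Integrable X P₀)
    (hm₁ : Measurable φ₁) (h₁ : φ₁ ∈ Phi0) (h₂ : φ₂ ∈ Phi0)
    {r : ℝ} (hr : 0 < r) (h : rhoS φ₁ φ₂ r P₀ X < ⊤) :
    ∃ θ₁ θ₂ lam : ℝ, 0 ≤ lam ∧ ∫⁻ ω, (scaledConj φ₂ lam
      (conj φ₁ ((θ₂ - X ω : ℝ) : EReal) + (θ₁ : EReal))).toENNReal ∂P₀ < ⊤ := by
  obtain ⟨M, hM, -⟩ := EReal.lt_iff_exists_real_btwn.1 h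
  obtain ⟨c, hc⟩ := exists_eventually_mem_moments_image hX h₁ h₂ hr
  obtain ⟨f, C, hf⟩ := exists_affine_bound (convex_moments_image hX h₁ h₂)
    (fun p t t' hp ht => moments_image_relax hX hp le_rfl ht) (M := M)
    (fun t ht => by
      obtain ⟨Q, R, -, hRQ, hdiv, hobj⟩ := exists_probabilityMeasures hX hm₁ h₁ ht
      have hle : oceObjective φ₁ X (R : Measure Ω) (Q : Measure Ω) ≤ rhoS φ₁ φ₂ r P₀ X :=
        le_iSup_of_le Q (le_iSup_of_le hdiv (le_iSup_of_le R (le_iSup_of_le hRQ le_rfl)))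
      exact EReal.coe_le_coe_iff.1 ((hobj.trans hle).trans hM.le)) hc
  have hsplit : ∀ m n u : ℝ, f (m, n, u) = m * f (1, 0, 0) + n * f (0, 1, 0) + u * f (0, 0, 1) := by
    intro m n u
    have : ((m, n, u) : ℝ × ℝ × ℝ)
        = m • ((1, 0, 0) : ℝ × ℝ × ℝ) + n • ((0, 1, 0) : ℝ × ℝ × ℝ)
          + u • ((0, 0, 1) : ℝ × ℝ × ℝ) := by simp
    rw [this, map_add, map_add, map_smul, map_smul, map_smul]
    simp only [smul_eq_mul]
  set α := f (1, 0, 0)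
  set β := f (0, 1, 0)
  set γ := f (0, 0, 1)
  -- The radius coordinate can be raised freely at value `c`; a negative slope would push the affine
  -- bound below `c`.
  have hγ : 0 ≤ γ := by
    by_contra hneg
    rw [not_le] at hneg
    have hbase := hc.self_of_nhds
    have hu : ∀ u, r ≤ u → c ≤ 1 * α + 1 * β + u * γ + C := fun u hu => by
      rw [← hsplit]
      exact hf _ _ (moments_image_relax hX hbase hu le_rfl)
    have h0 := hu r le_rfl
    have h3 := hu (r + (1 * α + 1 * β + r * γ + C - c + 1) / (-γ))
      (le_add_of_nonneg_right (div_nonneg (by linarith) (by linarith)))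
    have h4 : (1 * α + 1 * β + r * γ + C - c + 1) / (-γ) * γ
        = -(1 * α + 1 * β + r * γ + C - c + 1) := by
      field_simp [hneg.ne]
    rw [add_mul, h4] at h3
    linarith
  -- Since `E b ≥ 0`, enlarging the multiplier to `γ + 1` only lowers the Lagrangian, and it makes
  -- `lam` positive, avoiding the degenerate convention.
  refine ⟨-β, -α, γ + 1, by linarith,
    lintegral_scaledConj_lt_top hXm hX h₁ h₂ (by linarith) (C := C) fun Y hY => ?_⟩
  have hb0 : 0 ≤ (moments hX Y).1.2.2 := integral_nonneg fun ω => (hY ω).2.2.1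
  have hle := hf (moments hX Y).1 (moments hX Y).2 ⟨Y, hY, rfl⟩
  rw [show (moments hX Y).1
    = ((moments hX Y).1.1, (moments hX Y).1.2.1, (moments hX Y).1.2.2) from rfl, hsplit] at hle
  rw [integral_lagrangian hX]
  linarith

theorem exists_lintegral_lt_top_of_rhoL (hXm : Measurable X) (hX : Integrable X P₀)
    (hm₁ : Measurable φ₁) (h₁ : φ₁ ∈ Phi0) (h₂ : φ₂ ∈ Phi0)
    (h : rhoL φ₁ φ₂ P₀ X < ⊤) :
    ∃ θ₁ θ₂ : ℝ, ∫⁻ ω, (scaledConj φ₂ 1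
      (conj φ₁ ((θ₂ - X ω : ℝ) : EReal) + (θ₁ : EReal))).toENNReal ∂P₀ < ⊤ := by
  obtain ⟨M, hM, -⟩ := EReal.lt_iff_exists_real_btwn.1 h
  obtain ⟨c, hc⟩ := exists_eventually_mem_moments_image hX h₁ h₂ one_pos
  -- The second penalty moves from constraint to objective: `u` is projected out after being
  -- subtracted from the value, which fixes its multiplier at `1`.
  let B : Set ((ℝ × ℝ) × ℝ) :=
    {p | ∃ u, ((p.1.1, p.1.2, u), p.2 + u) ∈ moments hX '' admissible Ω φ₁ φ₂}
  have hB : Convex ℝ B := by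
    rintro ⟨⟨m, n⟩, t⟩ ⟨u, hu⟩ ⟨⟨m', n'⟩, t'⟩ ⟨u', hu'⟩ a b ha hb hab
    refine ⟨a * u + b * u', ?_⟩
    convert convex_moments_image hX h₁ h₂ hu hu' ha hb hab using 1
    simp only [Prod.smul_mk, Prod.mk_add_mk, smul_eq_mul]
    congr 1
    ring
  have hBnb : ∀ᶠ p : ℝ × ℝ in 𝓝 (1, 1), (p, c - 1) ∈ B := by
    have hcont : Filter.Tendsto (fun p : ℝ × ℝ => (p.1, p.2, (1 : ℝ))) (𝓝 (1, 1))
        (𝓝 (1, 1, 1)) := Continuous.tendsto (by fun_prop) ((1, 1) : ℝ × ℝ)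
    filter_upwards [hcont.eventually hc] with p hp
    exact ⟨1, by simpa using hp⟩
  obtain ⟨f, C, hf⟩ := exists_affine_bound hB
    (fun p t t' ⟨u, hu⟩ ht => ⟨u, moments_image_relax hX hu le_rfl (by simpa using ht)⟩) (M := M)
    (fun t ⟨u, ht⟩ => by
      obtain ⟨Q, R, hQ, hRQ, hdiv, hobj⟩ := exists_probabilityMeasures hX hm₁ h₁ ht
      have hu0 : 0 ≤ u := by
        obtain ⟨Y, hY, hYm⟩ := ht
        have : (moments hX Y).1.2.2 = u := by rw [hYm]
        rw [← this]
        exact integral_nonneg fun ω => (hY ω).2.2.1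
      have hle : oceObjective φ₁ X (R : Measure Ω) (Q : Measure Ω)
          - ((divergence φ₂ (Q : Measure Ω) P₀ : ℝ≥0∞) : EReal) ≤ rhoL φ₁ φ₂ P₀ X :=
        le_iSup_of_le Q (le_iSup_of_le hQ (le_iSup_of_le R (le_iSup_of_le hRQ le_rfl)))
      have hdiv' : ((divergence φ₂ (Q : Measure Ω) P₀ : ℝ≥0∞) : EReal) ≤ (u : EReal) := by
        refine (EReal.coe_ennreal_le_coe_ennreal_iff.2 hdiv).trans (le_of_eq ?_)
        rw [coe_toReal_ennreal ENNReal.ofReal_ne_top, ENNReal.toReal_ofReal hu0]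
      have h5 := ((EReal.sub_le_sub hobj hdiv').trans hle).trans hM.le
      rw [← EReal.coe_sub, EReal.coe_le_coe_iff] at h5
      simpa using h5) hBnb
  have hsplit : ∀ m n : ℝ, f (m, n) = m * f (1, 0) + n * f (0, 1) := by
    intro m n
    have : ((m, n) : ℝ × ℝ) = m • ((1, 0) : ℝ × ℝ) + n • ((0, 1) : ℝ × ℝ) := by simp
    rw [this, map_add, map_smul, map_smul]
    simp only [smul_eq_mul]
  refine ⟨-f (0, 1), -f (1, 0),
    lintegral_scaledConj_lt_top hXm hX h₁ h₂ one_pos (C := C) fun Y hY => ?_⟩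
  have hle := hf ((moments hX Y).1.1, (moments hX Y).1.2.1)
    ((moments hX Y).2 - (moments hX Y).1.2.2)
    ⟨(moments hX Y).1.2.2, Y, hY, by rw [sub_add_cancel]⟩
  rw [hsplit] at hle
  rw [integral_lagrangian hX]
  linarith

end RobustOCE

/-! ### The two equivalences. -/

theorem corollary1 {Ω : Type*} [MeasurableSpace Ω] (P₀ : Measure Ω) [IsProbabilityMeasure P₀]
    (X : Ω → ℝ) (hXm : Measurable X) (hX : Integrable X P₀)
    (μ : Measure ℝ) [SigmaFinite μ] (f₀ : ℝ → ℝ) (hf₀m : Measurable f₀) (hf₀ : ∀ x, 0 ≤ f₀ x)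
    (hdens : Measure.map X P₀ = μ.withDensity (fun x => ENNReal.ofReal (f₀ x)))
    (φ₁ φ₂ : ℝ → ℝ≥0∞) (hφ₁ : φ₁ ∈ RobustOCE.Phi0) (hφ₂ : φ₂ ∈ RobustOCE.Phi0)
    (hφ₁lsc : LowerSemicontinuous φ₁) (hφ₂lsc : LowerSemicontinuous φ₂)
    (r : ℝ) (hr : 0 < r) :
    (RobustOCE.rhoS φ₁ φ₂ r P₀ X < ⊤ ↔
      ∃ θ₁ θ₂ lam : ℝ, 0 ≤ lam ∧
        RobustOCE.extIntegral μ (fun x =>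
          RobustOCE.scaledConj φ₂ lam
            (RobustOCE.conj φ₁ ((θ₂ - x : ℝ) : EReal) + (θ₁ : EReal)) * (f₀ x : EReal)) < ⊤) ∧
    (RobustOCE.rhoL φ₁ φ₂ P₀ X < ⊤ ↔
      ∃ θ₁ θ₂ : ℝ,
        RobustOCE.extIntegral μ (fun x =>
          RobustOCE.conj φ₂
            (RobustOCE.conj φ₁ ((θ₂ - x : ℝ) : EReal) + (θ₁ : EReal)) * (f₀ x : EReal)) < ⊤) := by
  have hm₁ : Measurable φ₁ := hφ₁lsc.measurable
  have hm₂ : Measurable φ₂ := hφ₂lsc.measurable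
  have hd₁ := hφ₁.2.2.1
  have hd₂ := hφ₂.2.2.1
  have key : ∀ θ₁ θ₂ lam : ℝ, 0 ≤ lam → (RobustOCE.extIntegral μ (fun x =>
      RobustOCE.scaledConj φ₂ lam
        (RobustOCE.conj φ₁ ((θ₂ - x : ℝ) : EReal) + (θ₁ : EReal)) * (f₀ x : EReal)) < ⊤ ↔
      ∫⁻ ω, (RobustOCE.scaledConj φ₂ lam
        (RobustOCE.conj φ₁ ((θ₂ - X ω : ℝ) : EReal) + (θ₁ : EReal))).toENNReal ∂P₀ < ⊤) :=
    fun θ₁ θ₂ lam hlam => RobustOCE.extIntegral_density_lt_top_iff hXm hf₀m hf₀ hdens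
      (RobustOCE.measurable_scaledConj_comp hd₁ hd₂ hlam θ₁ θ₂)
  refine ⟨⟨fun h => ?_, ?_⟩, ⟨fun h => ?_, ?_⟩⟩
  · obtain ⟨θ₁, θ₂, lam, hlam, hfin⟩ :=
      RobustOCE.exists_lintegral_lt_top_of_rhoS hXm hX hm₁ hφ₁ hφ₂ hr h
    exact ⟨θ₁, θ₂, lam, hlam, (key θ₁ θ₂ lam hlam).2 hfin⟩
  · rintro ⟨θ₁, θ₂, lam, hlam, hfin⟩
    exact RobustOCE.rhoS_lt_top_of_lintegral hXm hm₁ hm₂ hd₁ hd₂ r hlam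
      ((key θ₁ θ₂ lam hlam).1 hfin)
  · obtain ⟨θ₁, θ₂, hfin⟩ :=
      RobustOCE.exists_lintegral_lt_top_of_rhoL hXm hX hm₁ hφ₁ hφ₂ h
    refine ⟨θ₁, θ₂, ?_⟩
    simp only [← RobustOCE.scaledConj_one φ₂]
    exact (key θ₁ θ₂ 1 zero_le_one).2 hfin
  · rintro ⟨θ₁, θ₂, hfin⟩
    simp only [← RobustOCE.scaledConj_one φ₂] at hfin
    exact RobustOCE.rhoL_lt_top_of_lintegral hXm hm₁ hm₂ hd₁ hd₂
      ((key θ₁ θ₂ 1 zero_le_one).1 hfin)
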